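/- For a finite-dimensional complex Lie algebra $\mathfrak{a}$ let $\mu(\mathfrak{a})$ denote the minimal dimension of a faithful linear representation of $\mathfrak{a}$, i.e. the least integer $n\ge 0$ for which there is an injective homomorphism of complex Lie algebras $\mathfrak{a}\to\mathfrak{gl}_n(\mathbb{C})$ (such an $n$ exists by Ado's theorem). Let $\mathfrak{s}$ be a finite-dimensional complex semisimple Lie algebra and let $\mathfrak{g}$ be a finite-dimensional complex Lie algebra that is perfect, i.e. satisfies $[\mathfrak{g},\mathfrak{g}]=\mathfrak{g}$. Then \[ \mu(\mathfrak{s}\oplus\mathfrak{g})=\mu(\mathfrak{s})+\mu(\mathfrak{g}). \] -/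

import Mathlib

section

/- The endomorphism ring of a vector space is viewed as the Lie algebra `𝔤𝔩` with the commutator
bracket. -/
attribute [local instance] LieRing.ofAssociativeRing

/-- The invariant `μ(L)` of a Lie algebra `L` over a field `K`: the minimal dimension `n` of a
faithful (that is, injective) finite-dimensional linear representation `L → 𝔤𝔩(Kⁿ)`.
The value lies in `ℕ∞`; a Lie algebra without a faithful finite-dimensional representation
would have the value `⊤` (an infimum over the empty set), never a junk natural number.
The zero-dimensional representation is allowed, so the zero Lie algebra has the value `0`. -/
noncomputable def minFaithfulDim (K L : Type*) [Field K] [LieRing L] [LieAlgebra K L] : ℕ∞ :=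
  sInf {d : ℕ∞ | ∃ n : ℕ, d = n ∧
    ∃ ρ : L →ₗ⁅K⁆ Module.End K (Fin n → K), Function.Injective ρ}

end

/-! The bound `≤` is a direct sum of representations. For `≥`, let `A` be the associative algebra
generated by `𝔰` in `End V`, with blocks of size `d i` modulo its radical, and lift primitive
idempotents `e i`, of ranks `m i`; then `∑ d i * m i ≤ dim V`. Only nilpotent elements die in the
quotient, so `𝔰` acts faithfully on the sum of the `K ^ d i`. As `𝔤` commutes with `A`, it acts on
the ranges of the `e i`, jointly faithfully because they generate the unit ideal. Perfect algebras
act by zero in dimension one, so such summands can be dropped, and `d + m ≤ d * m` once both are at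
least two. -/

section MinFaithfulDim

attribute [local instance] LieRing.ofAssociativeRing

open Module

/-- A homomorphism with commutative image vanishes on a perfect Lie algebra. -/
theorem LieHom.apply_eq_zero_of_perfect {K L L' : Type*} [CommRing K] [LieRing L] [LieAlgebra K L]
    [LieRing L'] [LieAlgebra K L'] (hL : ⁅(⊤ : LieIdeal K L), (⊤ : LieIdeal K L)⁆ = ⊤)
    (f : L →ₗ⁅K⁆ L') (hf : ∀ x y, ⁅f x, f y⁆ = 0) (x : L) : f x = 0 := by
  have h : ⁅(⊤ : LieIdeal K L), (⊤ : LieIdeal K L)⁆ ≤ f.ker := by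
    rw [LieSubmodule.lie_le_iff]
    intro x _ y _
    rw [LieHom.mem_ker, LieHom.map_lie, hf]
  rw [hL] at h
  exact LieHom.mem_ker.1 (h (LieSubmodule.mem_top x))

/-- A minimal ideal is nonabelian, so it equals its own bracket, and the minimal ideals span. -/
theorem LieAlgebra.IsSemisimple.lie_top_top {K L : Type*} [CommRing K] [LieRing L]
    [LieAlgebra K L] [LieAlgebra.IsSemisimple K L] :
    ⁅(⊤ : LieIdeal K L), (⊤ : LieIdeal K L)⁆ = ⊤ := by
  rw [eq_top_iff, ← LieAlgebra.IsSemisimple.sSup_atoms_eq_top (R := K) (L := L)]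
  refine sSup_le fun I hI => ?_
  have hle : ⁅I, I⁆ ≤ I := LieSubmodule.lie_le_right I I
  rcases hI.le_iff.1 hle with h | h
  · refine absurd ?_ (LieAlgebra.IsSemisimple.non_abelian_of_isAtom I hI)
    exact (LieSubmodule.lie_abelian_iff_lie_self_eq_bot I).2 h
  · calc I = ⁅I, I⁆ := h.symm
      _ ≤ _ := LieSubmodule.mono_lie (le_sSup hI) (le_sSup hI)

/-- The direct sum of a family of representations. -/
def LieHom.piRep {K L ι : Type*} [CommRing K] [LieRing L] [LieAlgebra K L] {V : ι → Type*}
    [∀ i, AddCommGroup (V i)] [∀ i, Module K (V i)] (ρ : ∀ i, L →ₗ⁅K⁆ End K (V i)) :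
    L →ₗ⁅K⁆ End K (∀ i, V i) where
  toFun x := LinearMap.pi fun i => ρ i x ∘ₗ LinearMap.proj i
  map_add' x y := by ext; simp
  map_smul' c x := by ext; simp
  map_lie' {x y} := by
    refine LinearMap.ext fun v => funext fun i => ?_
    simp [LieRing.of_associative_ring_bracket]

/-- The restriction of a representation to a stable subspace. -/
def LieHom.restrictRep {K L V : Type*} [CommRing K] [LieRing L] [LieAlgebra K L]
    [AddCommGroup V] [Module K V] (ρ : L →ₗ⁅K⁆ End K V) (p : Submodule K V)
    (hp : ∀ x, ∀ v ∈ p, ρ x v ∈ p) : L →ₗ⁅K⁆ End K p where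
  toFun x := (ρ x).restrict (hp x)
  map_add' x y := by ext; simp
  map_smul' c x := by ext; simp
  map_lie' {x y} := by
    ext v
    simp [LieRing.of_associative_ring_bracket]

/-! ### Bounds by direct sums, and passage modulo a nil ideal -/

section Field

variable {K L L' : Type*} [Field K] [LieRing L] [LieAlgebra K L] [LieRing L'] [LieAlgebra K L']

theorem minFaithfulDim_le_finrank {V : Type*} [AddCommGroup V] [Module K V]
    [FiniteDimensional K V] (ρ : L →ₗ⁅K⁆ End K V) (hρ : Function.Injective ρ) :
    minFaithfulDim K L ≤ finrank K V := by
  let e : V ≃ₗ[K] (Fin (finrank K V) → K) := (finBasis K V).equivFun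
  exact sInf_le ⟨_, rfl, e.lieConj.toLieHom.comp ρ, e.lieConj.injective.comp hρ⟩

theorem minFaithfulDim_le_sum {ι : Type*} (T : Finset ι) {V : ι → Type*}
    [∀ i, AddCommGroup (V i)] [∀ i, Module K (V i)] [∀ i, FiniteDimensional K (V i)]
    (ρ : ∀ i, L →ₗ⁅K⁆ End K (V i)) (hρ : ∀ x, (∀ i ∈ T, ρ i x = 0) → x = 0) :
    minFaithfulDim K L ≤ (∑ i ∈ T, finrank K (V i) : ℕ) := by
  classical
  refine (minFaithfulDim_le_finrank (LieHom.piRep fun i : T => ρ i) ?_).trans ?_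
  · refine (injective_iff_map_eq_zero _).2 fun x hx => hρ x fun i hi => ?_
    ext v
    have := congrFun (LinearMap.congr_fun hx (Pi.single ⟨i, hi⟩ v)) ⟨i, hi⟩
    simpa [LieHom.piRep] using this
  · rw [finrank_pi_fintype, Finset.sum_coe_sort T fun i => finrank K (V i)]

theorem exists_injective_of_minFaithfulDim_ne_top (h : minFaithfulDim K L ≠ ⊤) :
    ∃ n : ℕ, minFaithfulDim K L = n ∧
      ∃ ρ : L →ₗ⁅K⁆ End K (Fin n → K), Function.Injective ρ := by
  refine csInf_mem (s := {d : ℕ∞ | ∃ n : ℕ, d = n ∧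
    ∃ ρ : L →ₗ⁅K⁆ Module.End K (Fin n → K), Function.Injective ρ}) ?_
  by_contra hne
  rw [Set.not_nonempty_iff_eq_empty] at hne
  exact h (by rw [minFaithfulDim, hne, sInf_empty])

theorem minFaithfulDim_prod_le :
    minFaithfulDim K (L × L') ≤ minFaithfulDim K L + minFaithfulDim K L' := by
  by_cases h : minFaithfulDim K L = ⊤
  · simp [h]
  by_cases h' : minFaithfulDim K L' = ⊤
  · simp [h']
  obtain ⟨n, hn, ρ, hρ⟩ := exists_injective_of_minFaithfulDim_ne_top h
  obtain ⟨m, hm, σ, hσ⟩ := exists_injective_of_minFaithfulDim_ne_top h'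
  rw [hn, hm]
  let τ : L × L' →ₗ⁅K⁆ End K ((Fin n → K) × (Fin m → K)) :=
    { toFun := fun x => (ρ x.1).prodMap (σ x.2)
      map_add' := fun x y => by ext <;> simp
      map_smul' := fun c x => by ext <;> simp
      map_lie' := fun {x y} => by
        refine LinearMap.ext fun v => Prod.ext ?_ ?_ <;>
        simp [LieRing.of_associative_ring_bracket] }
  refine (minFaithfulDim_le_finrank τ ?_).trans (by simp)
  refine (injective_iff_map_eq_zero τ).2 fun x hx => Prod.ext ?_ ?_
  · refine (injective_iff_map_eq_zero ρ).1 hρ _ (LinearMap.ext fun v => ?_)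
    exact congrArg Prod.fst (LinearMap.congr_fun hx (v, 0))
  · refine (injective_iff_map_eq_zero σ).1 hσ _ (LinearMap.ext fun v => ?_)
    exact congrArg Prod.snd (LinearMap.congr_fun hx (0, v))

/-- A Lie algebra with trivial radical embeds modulo any nil ideal. -/
theorem LieHom.injective_comp_of_isNilpotent_ker [FiniteDimensional K L]
    [LieAlgebra.HasTrivialRadical K L] {A B : Type*} [Ring A] [Algebra K A] [Ring B] [Algebra K B]
    (ρ : L →ₗ⁅K⁆ A) (hρ : Function.Injective ρ) (π : A →ₐ[K] B)
    (hπ : ∀ a, π a = 0 → IsNilpotent a) : Function.Injective fun x => π (ρ x) := by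
  let f : L →ₗ⁅K⁆ B := π.toLieHom.comp ρ
  -- Engel: `ρ x` is nilpotent for `x` in the kernel, so its `ad` is nilpotent on `A`, and
  -- injectivity of `ρ` pulls this back to `L`.
  have hnil : LieRing.IsNilpotent f.ker := by
    rw [LieAlgebra.isNilpotent_iff_forall (R := K)]
    rintro ⟨x, hx⟩
    refine LieSubalgebra.isNilpotent_ad_of_isNilpotent_ad (f.ker : LieSubalgebra K L)
      (x := ⟨x, hx⟩) ?_
    obtain ⟨n, hn⟩ := LieAlgebra.ad_nilpotent_of_nilpotent (R := K) (hπ _ (LieHom.mem_ker.1 hx))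
    refine ⟨n, LinearMap.ext fun y => hρ ?_⟩
    have key : ∀ (k : ℕ) (y : L),
        ρ (((LieAlgebra.ad K L x) ^ k) y) = ((LieAlgebra.ad K A (ρ x)) ^ k) (ρ y) := by
      intro k
      induction k with
      | zero => intro y; simp
      | succ k ih => intro y; rw [pow_succ, pow_succ]; simp [ih]
    exact (key n y).trans ((LinearMap.congr_fun hn (ρ y)).trans ρ.map_zero.symm)
  have hbot : f.ker = ⊥ := LieAlgebra.HasTrivialRadical.eq_bot_of_isSolvable f.ker
  exact (LieHom.ker_eq_bot f).1 hbot

end Field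

/-! ### Wedderburn blocks and lifted idempotents -/

/-- Wedderburn's theorem modulo the Jacobson radical. -/
theorem exists_surjective_pi_matrix_of_isAlgClosed (F A : Type*) [Field F] [IsAlgClosed F]
    [Ring A] [Algebra F A] [FiniteDimensional F A] :
    ∃ (n : ℕ) (d : Fin n → ℕ), (∀ i, NeZero (d i)) ∧
      ∃ π : A →ₐ[F] Π i, Matrix (Fin (d i)) (Fin (d i)) F,
        Function.Surjective π ∧ ∀ a, π a = 0 → IsNilpotent a := by
  have : IsArtinianRing A := IsArtinianRing.of_finite F A
  obtain ⟨n, d, hd, ⟨e⟩⟩ :=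
    IsSemisimpleRing.exists_algEquiv_pi_matrix_of_isAlgClosed F (A ⧸ Ring.jacobson A)
  refine ⟨n, d, hd, e.toAlgHom.comp (Ideal.Quotient.mkₐ F (Ring.jacobson A)),
    e.surjective.comp Ideal.Quotient.mk_surjective, fun a ha => ?_⟩
  have ha' : Ideal.Quotient.mk (Ring.jacobson A) a = 0 := by simpa using ha
  rw [Ideal.Quotient.eq_zero_iff_mem] at ha'
  obtain ⟨k, hk⟩ := IsSemiprimaryRing.isNilpotent (R := A)
  exact ⟨k, by simpa [hk] using Ideal.pow_mem_pow ha' k⟩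

theorem LinearMap.finrank_range_mul_mul_le {K V : Type*} [Field K] [AddCommGroup V] [Module K V]
    [FiniteDimensional K V] (a b c : End K V) :
    finrank K (LinearMap.range (a * b * c)) ≤ finrank K (LinearMap.range b) := by
  have h1 : LinearMap.range (a * b * c) ≤ (LinearMap.range b).map a := by
    rintro _ ⟨v, rfl⟩
    exact ⟨b (c v), ⟨_, rfl⟩, rfl⟩
  exact (Submodule.finrank_mono h1).trans (Submodule.finrank_map_le _ _)

/-- In characteristic zero the trace of an idempotent determines its rank, and traces add. -/
theorem CompleteOrthogonalIdempotents.finrank_eq_sum {K V ι : Type*} [Field K] [CharZero K]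
    [AddCommGroup V] [Module K V] [FiniteDimensional K V] [Fintype ι] {e : ι → End K V}
    (he : CompleteOrthogonalIdempotents e) :
    finrank K V = ∑ i, finrank K (LinearMap.range (e i)) := by
  have h := congrArg (LinearMap.trace K V) he.complete
  rw [map_sum, LinearMap.trace_one] at h
  rw [Finset.sum_congr rfl fun i _ => (LinearMap.IsIdempotentElem.isProj_range _ (he.idem i)).trace]
    at h
  exact_mod_cast h.symm

theorem Matrix.completeOrthogonalIdempotents_single {ι K : Type*} [Fintype ι] [DecidableEq ι]
    [CommRing K] {d : ι → ℕ} :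
    CompleteOrthogonalIdempotents (fun s : Σ i, Fin (d i) =>
      (Pi.single s.1 (Matrix.single s.2 s.2 1) : Π i, Matrix (Fin (d i)) (Fin (d i)) K)) where
  idem s := by
    rw [IsIdempotentElem, ← Pi.single_mul]; simp
  ortho := by
    rintro ⟨i, j⟩ ⟨i', j'⟩ h
    rcases eq_or_ne i i' with rfl | hi
    · have hj : j ≠ j' := fun hj => h (by rw [hj])
      change Pi.single i _ * Pi.single i _ = 0
      rw [← Pi.single_mul, Matrix.single_mul_single_of_ne _ _ _ _ hj, Pi.single_zero]
    · ext k : 1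
      rcases eq_or_ne k i with rfl | hk
      · simp [Pi.single_eq_of_ne hi]
      · simp [Pi.single_eq_of_ne hk]
  complete := by
    rw [Fintype.sum_sigma]
    have : ∀ i, ∑ j, (Pi.single i (Matrix.single j j 1) : Π i, Matrix (Fin (d i)) (Fin (d i)) K)
        = Pi.single i 1 := by
      intro i
      rw [← Matrix.sum_single_one]
      exact (map_sum (AddMonoidHom.single (fun i => Matrix (Fin (d i)) (Fin (d i)) K) i) _ _).symm
    simp only [this]
    exact Finset.univ_sum_single (1 : Π i, Matrix (Fin (d i)) (Fin (d i)) K)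

/-- Primitive idempotents of an algebra of operators, one for each block of its semisimple
quotient: together they generate the unit ideal, and their ranks, weighted by the sizes of the
blocks, add up to at most the dimension of the space. -/
theorem Subalgebra.exists_idempotents_of_surjective_pi_matrix {K V : Type*} [Field K] [CharZero K]
    [AddCommGroup V] [Module K V] [FiniteDimensional K V] (A : Subalgebra K (End K V)) {n : ℕ}
    {d : Fin n → ℕ} [∀ i, NeZero (d i)] (π : A →ₐ[K] Π i, Matrix (Fin (d i)) (Fin (d i)) K)
    (hsurj : Function.Surjective π) (hnil : ∀ a, π a = 0 → IsNilpotent a) :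
    ∃ e : Fin n → A, (∀ i, e i ≠ 0) ∧
      ∑ i, d i * finrank K (LinearMap.range (e i : End K V)) ≤ finrank K V ∧
      ∀ x : End K V, (∀ a ∈ A, Commute x a) → (∀ i, x * (e i : End K V) = 0) → x = 0 := by
  -- Turns congruences modulo the kernel of `π` into exact identities, up to a unit.
  have hunit : ∀ k : A, π k = 0 → ∃ u : End K V, (1 - (k : End K V)) * u = 1 := by
    intro k hk
    have h : IsUnit (1 - (k : End K V)) := ((hnil k hk).map A.val).isUnit_one_sub
    exact h.exists_right_inv
  obtain ⟨e, he, hπe⟩ := CompleteOrthogonalIdempotents.lift_of_isNilpotent_ker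
    (π : A →+* Π i, Matrix (Fin (d i)) (Fin (d i)) K) (fun x hx => hnil x hx)
    (Matrix.completeOrthogonalIdempotents_single (K := K) (d := d))
    (fun s => by obtain ⟨a, ha⟩ := hsurj _; exact ⟨a, ha⟩)
  have hπ : ∀ i j, π (e ⟨i, j⟩) = Pi.single i (Matrix.single j j 1) := fun i j => congrFun hπe ⟨i, j⟩
  choose a ha using fun i (j : Fin (d i)) => hsurj (Pi.single i (Matrix.single j 0 1))
  choose b hb using fun i (j : Fin (d i)) => hsurj (Pi.single i (Matrix.single 0 j 1))
  refine ⟨fun i => e ⟨i, 0⟩, fun i h0 => ?_, ?_, fun x hx hxe => ?_⟩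
  · have h := congrFun (hπ i 0) i
    change e ⟨i, 0⟩ = 0 at h0
    rw [h0, map_zero, Pi.zero_apply, Pi.single_eq_same] at h
    have := congrFun (congrFun h 0) 0
    simp at this
  · have hrank : ∀ i j, finrank K (LinearMap.range (e ⟨i, 0⟩ : End K V)) ≤
        finrank K (LinearMap.range (e ⟨i, j⟩ : End K V)) := by
      -- Since `E₀₀ E₀ⱼ Eⱼⱼ Eⱼ₀ = E₀₀`, the idempotent `e ⟨i, 0⟩` factors through `e ⟨i, j⟩` up to a
      -- unit.
      intro i j
      obtain ⟨u, hu⟩ := hunit (e ⟨i, 0⟩ - e ⟨i, 0⟩ * b i j * e ⟨i, j⟩ * a i j) (by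
        simp only [map_sub, map_mul, hπ, ha, hb, ← Pi.single_mul]
        simp)
      have hee : (e ⟨i, 0⟩ : End K V) * (e ⟨i, 0⟩ : End K V) = e ⟨i, 0⟩ :=
        congrArg Subtype.val (he.idem ⟨i, 0⟩)
      have key : (e ⟨i, 0⟩ : End K V) =
          ((e ⟨i, 0⟩ : End K V) * (b i j : End K V)) * (e ⟨i, j⟩ : End K V) *
            ((a i j : End K V) * u) := by
        calc (e ⟨i, 0⟩ : End K V) = e ⟨i, 0⟩ * ((1 - ((e ⟨i, 0⟩ - e ⟨i, 0⟩ * b i j * e ⟨i, j⟩ *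
              a i j : A) : End K V)) * u) := by rw [hu, mul_one]
          _ = _ := by
            push_cast
            simp only [← mul_assoc, mul_sub, mul_one, hee]
            simp
      rw [key]
      exact LinearMap.finrank_range_mul_mul_le _ _ _
    have hc : CompleteOrthogonalIdempotents (fun s => (e s : End K V)) := he.map A.val.toRingHom
    rw [hc.finrank_eq_sum, Fintype.sum_sigma]
    refine Finset.sum_le_sum fun i _ => ?_
    calc d i * finrank K (LinearMap.range (e ⟨i, 0⟩ : End K V))
        = ∑ _j : Fin (d i), finrank K (LinearMap.range (e ⟨i, 0⟩ : End K V)) := by simp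
      _ ≤ _ := Finset.sum_le_sum fun j _ => hrank i j
  -- The sum lifts `∑ Eⱼ₀ E₀₀ E₀ⱼ = 1`, so it is a unit; `x` moves past each `a` and is killed by
  -- the idempotent.
  · obtain ⟨u, hu⟩ := hunit (1 - ∑ s : Σ i, Fin (d i), a s.1 s.2 * e ⟨s.1, 0⟩ * b s.1 s.2) (by
      simp only [map_sub, map_sum, map_mul, hπ, ha, hb, ← Pi.single_mul, map_one]
      rw [← (Matrix.completeOrthogonalIdempotents_single (K := K) (d := d)).complete, sub_eq_zero]
      simp)
    have hx0 : x * (1 - ((1 - ∑ s : Σ i, Fin (d i), a s.1 s.2 * e ⟨s.1, 0⟩ * b s.1 s.2 : A) :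
        End K V)) = 0 := by
      push_cast
      rw [sub_sub_cancel, Finset.mul_sum]
      refine Finset.sum_eq_zero fun s _ => ?_
      rw [← mul_assoc, ← mul_assoc, (hx _ (a s.1 s.2).2).eq, mul_assoc _ x, hxe]
      simp
    calc x = x * (1 - ((1 - ∑ s : Σ i, Fin (d i), a s.1 s.2 * e ⟨s.1, 0⟩ * b s.1 s.2 : A) :
        End K V)) * u := by rw [mul_assoc, hu, mul_one]
      _ = 0 := by rw [hx0, zero_mul]

/-- The composite of a homomorphism into a product of matrix algebras with a projection. -/
noncomputable def LieHom.blockRep {K L A ι : Type*} [CommRing K] [LieRing L] [LieAlgebra K L]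
    [Ring A] [Algebra K A] {d : ι → ℕ} (ρ : L →ₗ⁅K⁆ A)
    (π : A →ₐ[K] Π i, Matrix (Fin (d i)) (Fin (d i)) K) (i : ι) :
    L →ₗ⁅K⁆ End K (Fin (d i) → K) :=
  ((Matrix.toLinAlgEquiv'.toAlgHom.comp (Pi.evalAlgHom K _ i)).comp π).toLieHom.comp ρ

/-- A perfect Lie algebra acts by zero on a space of dimension at most one. -/
theorem LieHom.apply_eq_zero_of_finrank_le_one {K L V : Type*} [Field K] [LieRing L]
    [LieAlgebra K L] [AddCommGroup V] [Module K V] [FiniteDimensional K V]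
    (hL : ⁅(⊤ : LieIdeal K L), (⊤ : LieIdeal K L)⁆ = ⊤) (hV : finrank K V ≤ 1)
    (ρ : L →ₗ⁅K⁆ End K V) (x : L) : ρ x = 0 := by
  refine ρ.apply_eq_zero_of_perfect hL (fun x y => ?_) x
  obtain ⟨v, hv⟩ := finrank_le_one_iff.1 hV
  ext w
  obtain ⟨c, rfl⟩ := hv w
  obtain ⟨r, hr⟩ := hv (ρ x v)
  obtain ⟨t, ht⟩ := hv (ρ y v)
  simp [LieRing.of_associative_ring_bracket, ← hr, ← ht, smul_comm r t]

/-! ### The lower bound -/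

theorem minFaithfulDim_add_le_of_injective {K 𝔰 𝔤 : Type*} [Field K] [CharZero K] [IsAlgClosed K]
    [LieRing 𝔰] [LieAlgebra K 𝔰] [FiniteDimensional K 𝔰] [LieAlgebra.HasTrivialRadical K 𝔰]
    [LieRing 𝔤] [LieAlgebra K 𝔤] {V : Type*} [AddCommGroup V] [Module K V] [FiniteDimensional K V]
    (hs : ⁅(⊤ : LieIdeal K 𝔰), (⊤ : LieIdeal K 𝔰)⁆ = ⊤)
    (hg : ⁅(⊤ : LieIdeal K 𝔤), (⊤ : LieIdeal K 𝔤)⁆ = ⊤)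
    (ρ : 𝔰 × 𝔤 →ₗ⁅K⁆ End K V) (hρ : Function.Injective ρ) :
    minFaithfulDim K 𝔰 + minFaithfulDim K 𝔤 ≤ finrank K V := by
  classical
  let A : Subalgebra K (End K V) := Algebra.adjoin K (Set.range fun x : 𝔰 => ρ (x, 0))
  let ρs : 𝔰 →ₗ⁅K⁆ A :=
    { toFun := fun x => ⟨ρ (x, 0), Algebra.subset_adjoin ⟨x, rfl⟩⟩
      map_add' := fun x y => Subtype.ext <| by
        change ρ (x + y, 0) = ρ (x, 0) + ρ (y, 0)
        rw [← map_add]; simp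
      map_smul' := fun c x => Subtype.ext <| by
        change ρ (c • x, 0) = c • ρ (x, 0)
        rw [← map_smul]; simp
      map_lie' := fun {x y} => Subtype.ext <| by
        change ρ (⁅x, y⁆, 0) = ⁅ρ (x, 0), ρ (y, 0)⁆
        rw [← LieHom.map_lie, LieAlgebra.Prod.bracket_apply, lie_self] }
  have hρs : Function.Injective ρs := fun x y h =>
    congrArg Prod.fst (hρ (congrArg Subtype.val h))
  let ρg : 𝔤 →ₗ⁅K⁆ End K V := ρ.comp (LieHom.inr K 𝔰 𝔤)
  have hρg : Function.Injective ρg := hρ.comp LieHom.inr_injective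
  have hcomm : ∀ y, ∀ a ∈ A, Commute (ρg y) a := by
    intro y a ha
    have hle : A ≤ Subalgebra.centralizer K {ρg y} := by
      refine Algebra.adjoin_le ?_
      rintro _ ⟨x, rfl⟩
      rw [SetLike.mem_coe, Subalgebra.mem_centralizer_iff]
      rintro _ rfl
      rw [← sub_eq_zero, ← LieRing.of_associative_ring_bracket]
      change ⁅ρ (0, y), ρ (x, 0)⁆ = 0
      rw [← LieHom.map_lie, LieAlgebra.Prod.bracket_apply, zero_lie, lie_zero]
      exact ρ.map_zero
    exact Subalgebra.mem_centralizer_iff K |>.1 (hle ha) _ rfl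
  obtain ⟨n, d, hd, π, hsurj, hnil⟩ := exists_surjective_pi_matrix_of_isAlgClosed K A
  obtain ⟨e, hne, hdim, hfull⟩ :=
    A.exists_idempotents_of_surjective_pi_matrix π hsurj hnil
  set m : Fin n → ℕ := fun i => finrank K (LinearMap.range (e i : End K V)) with hm
  have hd1 : ∀ i, 1 ≤ d i := fun i => Nat.one_le_iff_ne_zero.2 (NeZero.ne (d i))
  have hm1 : ∀ i, 1 ≤ m i := by
    intro i
    rw [Nat.one_le_iff_ne_zero]
    intro h0
    rw [hm, Submodule.finrank_eq_zero, LinearMap.range_eq_bot] at h0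
    exact hne i (Subtype.ext h0)
  have hS : minFaithfulDim K 𝔰 ≤ (∑ i with 2 ≤ d i, d i : ℕ) := by
    refine (minFaithfulDim_le_sum (Finset.univ.filter fun i => 2 ≤ d i) (ρs.blockRep π)
      fun x hx => ?_).trans (by simp)
    refine ρs.injective_comp_of_isNilpotent_ker hρs π hnil ?_
    have h0 : ∀ i, ρs.blockRep π i x = 0 := by
      intro i
      by_cases hi : 2 ≤ d i
      · exact hx i (by simpa using hi)
      · exact LieHom.apply_eq_zero_of_finrank_le_one hs (by simp; omega) _ x
    change π (ρs x) = π (ρs 0)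
    rw [map_zero, map_zero]
    funext i
    exact (map_eq_zero_iff _ Matrix.toLinAlgEquiv'.injective).1 (h0 i)
  have hG : minFaithfulDim K 𝔤 ≤ (∑ i with d i = 1 ∨ 2 ≤ m i, m i : ℕ) := by
    have hstab : ∀ i y, ∀ v ∈ LinearMap.range (e i : End K V),
        ρg y v ∈ LinearMap.range (e i : End K V) := by
      rintro i y _ ⟨v, rfl⟩
      exact ⟨ρg y v, (LinearMap.congr_fun (hcomm y _ (e i).2).eq v).symm⟩
    refine minFaithfulDim_le_sum (Finset.univ.filter fun i => d i = 1 ∨ 2 ≤ m i)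
      (fun i => ρg.restrictRep _ (hstab i)) fun y hy => ?_
    refine (injective_iff_map_eq_zero ρg).1 hρg y (hfull _ (hcomm y) fun i => ?_)
    have h0 : ρg.restrictRep _ (hstab i) y = 0 := by
      by_cases hi : 2 ≤ m i
      · exact hy i (by simp [hi])
      · exact LieHom.apply_eq_zero_of_finrank_le_one hg (by simp only [hm] at hi; omega) _ y
    ext v
    exact congrArg Subtype.val (LinearMap.congr_fun h0 ⟨_, ⟨v, rfl⟩⟩)
  have hcount : ∑ i with 2 ≤ d i, d i + ∑ i with d i = 1 ∨ 2 ≤ m i, m i ≤ finrank K V := by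
    refine le_trans ?_ hdim
    rw [Finset.sum_filter, Finset.sum_filter, ← Finset.sum_add_distrib]
    refine Finset.sum_le_sum fun i _ => ?_
    change _ ≤ d i * m i
    have h1 := hd1 i
    have h2 := hm1 i
    -- When both sizes are at least two, `(d i - 1) * (m i - 1) ≥ 1`; otherwise only one of the two
    -- terms survives.
    split_ifs with h3 h4 h4
    · have h5 : 2 ≤ m i := by omega
      nlinarith
    · nlinarith
    · nlinarith
    · omega
  calc minFaithfulDim K 𝔰 + minFaithfulDim K 𝔤
      ≤ (∑ i with 2 ≤ d i, d i : ℕ) + (∑ i with d i = 1 ∨ 2 ≤ m i, m i : ℕ) := add_le_add hS hG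
    _ ≤ finrank K V := by exact_mod_cast hcount

end MinFaithfulDim

theorem mainTheorem5
    (𝔰 𝔤 : Type*)
    [LieRing 𝔰] [LieAlgebra ℂ 𝔰] [FiniteDimensional ℂ 𝔰]
    [LieRing 𝔤] [LieAlgebra ℂ 𝔤] [FiniteDimensional ℂ 𝔤]
    (hs : LieAlgebra.IsSemisimple ℂ 𝔰)
    (hg : ⁅(⊤ : LieIdeal ℂ 𝔤), (⊤ : LieIdeal ℂ 𝔤)⁆ = ⊤) :
    minFaithfulDim ℂ (𝔰 × 𝔤) = minFaithfulDim ℂ 𝔰 + minFaithfulDim ℂ 𝔤 := by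
  refine le_antisymm minFaithfulDim_prod_le (le_sInf ?_)
  rintro _ ⟨n, rfl, ρ, hρ⟩
  simpa using minFaithfulDim_add_le_of_injective
    LieAlgebra.IsSemisimple.lie_top_top hg ρ hρ
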